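/- Let $\mathfrak{L}$ be a left Leibniz algebra over an algebraically closed field $\mathbb{F}$, i.e. an $\mathbb{F}$-vector space with a bilinear multiplication satisfying $x(yz)=(xy)z+y(xz)$. Assume that $\mathfrak{L}$ is supersolvable, i.e. that there is a finite chain $\mathfrak{L}=\mathfrak{L}_k\supset\mathfrak{L}_{k-1}\supset\cdots\supset\mathfrak{L}_1\supset\mathfrak{L}_0=0$ of (two-sided) ideals of $\mathfrak{L}$ with $\dim_{\mathbb{F}}\mathfrak{L}_j/\mathfrak{L}_{j-1}=1$ for $1\le j\le k$. Let $M$ be a finite-dimensional $\mathfrak{L}$-bimodule, i.e. a finite-dimensional $\mathbb{F}$-vector space with bilinear left and right actions of $\mathfrak{L}$ such that $$(xy)\cdot m=x\cdot(y\cdot m)-y\cdot(x\cdot m),\quad (x\cdot m)\cdot y=x\cdot(m\cdot y)-m\cdot(xy),\quad (m\cdot x)\cdot y=m\cdot(xy)-x\cdot(m\cdot y)$$ for all $x,y\in\mathfrak{L}$ and $m\in M$. Let $M_0$ be the subspace of $M$ spanned by all $x\cdot m+m\cdot x$ with $x\in\mathfrak{L}$, $m\in M$, and call $M$ symmetric if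 $m\cdot x=-x\cdot m$ for all $x\in\mathfrak{L}$, $m\in M$. Let $\mathrm{HL}^n(\mathfrak{L},M)=\mathrm{Ker}(\mathrm{d}^n)/\mathrm{Im}(\mathrm{d}^{n-1})$ for $n\ge 0$ (with $\mathrm{d}^{-1}=0$), where $\mathrm{d}^n:\mathrm{Hom}_{\mathbb{F}}(\mathfrak{L}^{\otimes n},M)\to\mathrm{Hom}_{\mathbb{F}}(\mathfrak{L}^{\otimes (n+1)},M)$ is given by $$(\mathrm{d}^nf)(x_1\otimes\dots\otimes x_{n+1})=\sum_{j=1}^n(-1)^{j+1}x_j\cdot f(x_1\otimes\dots\otimes\hat{x}_j\otimes\dots\otimes x_{n+1})+(-1)^{n+1}f(x_1\otimes\dots\otimes x_n)\cdot x_{n+1}$$ $$+\sum_{1\le i<j\le n+1}(-1)^if(x_1\otimes\dots\otimes\hat{x}_i\otimes\dots\otimes x_{j-1}\otimes x_ix_j\otimes x_{j+1}\otimes\dots\otimes x_{n+1}).$$ If no composition factor of the $\mathfrak{L}$-bimodule $M$ is one-dimensional, then $\mathrm{HL}^0(\mathfrak{L},M)\cong M_0$ as $\mathbb{F}$-vector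 spaces, and $\mathrm{HL}^n(\mathfrak{L},M)=0$ for every integer $n\ge 1$. If in addition $M$ is symmetric, then $\mathrm{HL}^n(\mathfrak{L},M)=0$ for every integer $n\ge 0$. -/

import Mathlib

namespace LeibnizCohomology

/-- The left Leibniz identity for an algebra with multiplication `*`: every left multiplication
operator `y ↦ x * y` is a derivation. (An `F`-algebra in the sense used here, i.e. a vector space
with a bilinear multiplication, is a `NonUnitalNonAssocRing` with `Module`, `IsScalarTower` and
`SMulCommClass` over `F`.) -/
class IsLeftLeibniz (L : Type*) [NonUnitalNonAssocRing L] : Prop where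
  leibniz : ∀ x y z : L, x * (y * z) = (x * y) * z + y * (x * z)

section Supersolvable

variable (F : Type*) [Field F] (L : Type*) [NonUnitalNonAssocRing L] [Module F L]

variable {F L} in
/-- A subspace is a (two-sided) ideal. -/
def IsIdeal (I : Submodule F L) : Prop :=
  ∀ (x : L), ∀ a ∈ I, x * a ∈ I ∧ a * x ∈ I

/-- `L` is supersolvable: there is a finite chain of ideals `0 = L₀ ⊆ L₁ ⊆ ⋯ ⊆ L_k = L` all of whose
successive quotients are one-dimensional. -/
def IsSupersolvable : Prop :=
  ∃ (k : ℕ) (I : Fin (k + 1) → Submodule F L),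
    I 0 = ⊥ ∧ I (Fin.last k) = ⊤ ∧ (∀ j, IsIdeal (I j)) ∧
    ∀ j : Fin k, I j.castSucc ≤ I j.succ ∧
      Module.finrank F (I j.succ ⧸ (I j.castSucc).submoduleOf (I j.succ)) = 1

end Supersolvable

/-- An `L`-bimodule structure on the vector space `M`: a bilinear left action
`left x m = x · m` and a bilinear right action `right x m = m · x`, subject to
(LLM), (LML) and (MLL). -/
structure Bimodule (F : Type*) [Field F] (L : Type*) [NonUnitalNonAssocRing L] [Module F L]
    (M : Type*) [AddCommGroup M] [Module F M] where
  left : L →ₗ[F] M →ₗ[F] M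
  right : L →ₗ[F] M →ₗ[F] M
  llm : ∀ (x y : L) (m : M), left (x * y) m = left x (left y m) - left y (left x m)
  lml : ∀ (x y : L) (m : M), right y (left x m) = left x (right y m) - right (x * y) m
  mll : ∀ (x y : L) (m : M), right y (right x m) = right (x * y) m - left x (right y m)

namespace Bimodule

variable {F : Type*} [Field F] {L : Type*} [NonUnitalNonAssocRing L] [Module F L]
  {M : Type*} [AddCommGroup M] [Module F M] (B : Bimodule F L M)

/-- `m · x = - x · m` for all `x` and `m`. -/
def IsSymmetric : Prop := ∀ (x : L) (m : M), B.right x m = - B.left x m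

/-- The anti-symmetric kernel `M₀`, spanned by all `x · m + m · x`. -/
def antiSymmetricKernel : Submodule F M :=
  Submodule.span F {v | ∃ (x : L) (m : M), v = B.left x m + B.right x m}

/-- A subspace is a subbimodule: it is stable under the left and the right action. -/
def IsSubbimodule (N : Submodule F M) : Prop :=
  ∀ (x : L), ∀ m ∈ N, B.left x m ∈ N ∧ B.right x m ∈ N

/-- A composition series `0 = N₀ ⊂ N₁ ⊂ ⋯ ⊂ N_k = M` of subbimodules: each factor
`N_{i+1} / N_i` is an irreducible bimodule, i.e. it is non-zero and there is no subbimodule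
strictly between `N_i` and `N_{i+1}`. -/
structure CompositionSeries where
  length : ℕ
  N : Fin (length + 1) → Submodule F M
  zero : N 0 = ⊥
  last : N (Fin.last length) = ⊤
  isSubbimodule : ∀ i, B.IsSubbimodule (N i)
  lt : ∀ i : Fin length, N i.castSucc < N i.succ
  irreducible : ∀ (i : Fin length) (P : Submodule F M), B.IsSubbimodule P →
    N i.castSucc ≤ P → P ≤ N i.succ → P = N i.castSucc ∨ P = N i.succ

variable {B} in
/-- The `i`-th composition factor `N_{i+1} / N_i` (its underlying vector space). -/
abbrev CompositionSeries.Factor (s : B.CompositionSeries) (i : Fin s.length) : Type _ :=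
  s.N i.succ ⧸ (s.N i.castSucc).submoduleOf (s.N i.succ)

/-- No composition factor of `M` is one-dimensional. -/
def NoOneDimCompositionFactor : Prop :=
  ∀ (s : B.CompositionSeries) (i : Fin s.length), Module.finrank F (s.Factor i) ≠ 1

end Bimodule

section Cohomology

variable {F : Type*} [Field F] {L : Type*} [NonUnitalNonAssocRing L] [Module F L]
  {M : Type*} [AddCommGroup M] [Module F M]

/-- The `n`-cochains: `n`-linear maps `L × ⋯ × L → M`, i.e. linear maps `L^{⊗ n} → M`. -/
abbrev Cochain (F : Type*) [Field F] (L : Type*) [NonUnitalNonAssocRing L] [Module F L]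
    (M : Type*) [AddCommGroup M] [Module F M] (n : ℕ) : Type _ :=
  MultilinearMap F (fun _ : Fin n => L) M

/-- The value of the coboundary of `f` at `x = (x₀, …, xₙ)`. The indices are `0`-based, so all
exponents of signs coming from an index are shifted by one. In the last sum the `j`-th entry is
replaced by `x i * x j` and then the `i`-th entry is deleted. -/
def coboundaryFun (B : Bimodule F L M) (n : ℕ) (f : Cochain F L M n) (x : Fin (n + 1) → L) : M :=
  ∑ j : Fin n, (-1 : F) ^ (j : ℕ) • B.left (x j.castSucc) (f (j.castSucc.removeNth x))
  + (-1 : F) ^ (n + 1) • B.right (x (Fin.last n)) (f ((Fin.last n).removeNth x))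
  + ∑ i : Fin (n + 1), ∑ j ∈ Finset.Ioi i,
      (-1 : F) ^ ((i : ℕ) + 1) • f (i.removeNth (Function.update x j (x i * x j)))

theorem action_update_add (A : L →ₗ[F] M →ₗ[F] M) {n : ℕ} (f : Cochain F L M n)
    (p k : Fin (n + 1)) (x : Fin (n + 1) → L) (a b : L) :
    A (Function.update x k (a + b) p) (f (p.removeNth (Function.update x k (a + b)))) =
      A (Function.update x k a p) (f (p.removeNth (Function.update x k a))) +
      A (Function.update x k b p) (f (p.removeNth (Function.update x k b))) := by
  rcases Fin.eq_self_or_eq_succAbove p k with rfl | ⟨k, rfl⟩ <;> simp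

theorem action_update_smul (A : L →ₗ[F] M →ₗ[F] M) {n : ℕ} (f : Cochain F L M n)
    (p k : Fin (n + 1)) (x : Fin (n + 1) → L) (c : F) (a : L) :
    A (Function.update x k (c • a) p) (f (p.removeNth (Function.update x k (c • a)))) =
      c • A (Function.update x k a p) (f (p.removeNth (Function.update x k a))) := by
  rcases Fin.eq_self_or_eq_succAbove p k with rfl | ⟨k, rfl⟩ <;> simp

theorem product_update_add {n : ℕ} (f : Cochain F L M n) (i j : Fin (n + 1)) (hij : j ≠ i)
    (k : Fin (n + 1)) (x : Fin (n + 1) → L) (a b : L) :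
    f (i.removeNth (Function.update (Function.update x k (a + b)) j
        (Function.update x k (a + b) i * Function.update x k (a + b) j))) =
      f (i.removeNth (Function.update (Function.update x k a) j
        (Function.update x k a i * Function.update x k a j))) +
      f (i.removeNth (Function.update (Function.update x k b) j
        (Function.update x k b i * Function.update x k b j))) := by
  obtain ⟨j, rfl⟩ := Fin.exists_succAbove_eq hij
  rcases Fin.eq_self_or_eq_succAbove i k with rfl | ⟨k, rfl⟩
  · simp [add_mul]
  · rcases eq_or_ne k j with rfl | hk
    · simp [mul_add]
    · have hne : i.succAbove j ≠ i.succAbove k := fun h =>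
        hk (Fin.succAbove_right_injective h).symm
      simp [Function.update_of_ne hne, Function.update_comm hk]

theorem product_update_smul [IsScalarTower F L L] [SMulCommClass F L L] {n : ℕ}
    (f : Cochain F L M n) (i j : Fin (n + 1)) (hij : j ≠ i)
    (k : Fin (n + 1)) (x : Fin (n + 1) → L) (c : F) (a : L) :
    f (i.removeNth (Function.update (Function.update x k (c • a)) j
        (Function.update x k (c • a) i * Function.update x k (c • a) j))) =
      c • f (i.removeNth (Function.update (Function.update x k a) j
        (Function.update x k a i * Function.update x k a j))) := by
  obtain ⟨j, rfl⟩ := Fin.exists_succAbove_eq hij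
  rcases Fin.eq_self_or_eq_succAbove i k with rfl | ⟨k, rfl⟩
  · simp [smul_mul_assoc]
  · rcases eq_or_ne k j with rfl | hk
    · simp [mul_smul_comm]
    · have hne : i.succAbove j ≠ i.succAbove k := fun h =>
        hk (Fin.succAbove_right_injective h).symm
      simp [Function.update_of_ne hne, Function.update_comm hk]

variable [IsScalarTower F L L] [SMulCommClass F L L]

/-- The coboundary operator `dⁿ : CLⁿ(L, M) → CLⁿ⁺¹(L, M)`. -/
def coboundary (B : Bimodule F L M) (n : ℕ) : Cochain F L M n →ₗ[F] Cochain F L M (n + 1) where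
  toFun f :=
    { toFun := coboundaryFun B n f
      map_update_add' := by
        intro inst x k a b
        rw [Subsingleton.elim inst (instDecidableEqFin (n + 1))]
        simp only [coboundaryFun]
        have h : ∀ i : Fin (n + 1), ∀ j ∈ Finset.Ioi i, j ≠ i := fun i j hj =>
          (Finset.mem_Ioi.1 hj).ne'
        simp only [action_update_add]
        rw [Finset.sum_congr rfl fun i _ => Finset.sum_congr rfl fun j hj => by
          rw [product_update_add f i j (h i j hj)]]
        simp only [smul_add, Finset.sum_add_distrib]
        abel
      map_update_smul' := by
        intro inst x k c a
        rw [Subsingleton.elim inst (instDecidableEqFin (n + 1))]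
        simp only [coboundaryFun]
        have h : ∀ i : Fin (n + 1), ∀ j ∈ Finset.Ioi i, j ≠ i := fun i j hj =>
          (Finset.mem_Ioi.1 hj).ne'
        simp only [action_update_smul]
        rw [Finset.sum_congr rfl fun i _ => Finset.sum_congr rfl fun j hj => by
          rw [product_update_smul f i j (h i j hj)]]
        simp only [smul_add, Finset.smul_sum, smul_comm c] }
  map_add' f g := by
    ext x
    simp only [coboundaryFun, MultilinearMap.coe_mk, add_apply, map_add, smul_add,
      Finset.sum_add_distrib]
    abel
  map_smul' c f := by
    ext x
    simp only [coboundaryFun, MultilinearMap.coe_mk, smul_apply, map_smul, smul_add,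
      Finset.smul_sum, smul_comm c, RingHom.id_apply]

/-- The cocycles `ZLⁿ(L, M) = Ker dⁿ`. -/
def cocycles (B : Bimodule F L M) (n : ℕ) : Submodule F (Cochain F L M n) :=
  LinearMap.ker (coboundary B n)

/-- The coboundaries `BLⁿ(L, M) = Im dⁿ⁻¹`, where `d⁻¹ = 0`. -/
def coboundaries (B : Bimodule F L M) : (n : ℕ) → Submodule F (Cochain F L M n)
  | 0 => ⊥
  | n + 1 => LinearMap.range (coboundary B n)

/-- The cohomology `HLⁿ(L, M) = ZLⁿ(L, M) / BLⁿ(L, M)`, where `BLⁿ(L, M)` is viewed as a subspace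
of `ZLⁿ(L, M)` (for a left Leibniz algebra `L` the composite of two coboundary operators is zero,
so that every coboundary is a cocycle). -/
abbrev HL (B : Bimodule F L M) (n : ℕ) : Type _ :=
  cocycles B n ⧸ (coboundaries B n).submoduleOf (cocycles B n)

end Cohomology
end LeibnizCohomology

/-!
For `x` in `L` let `θ_x` be the Lie derivative on the cochains `CLⁿ = Hom(L^{⊗ n}, M)`, i.e. the left
action induced by left multiplication on `L` and by the left action on `M`. In positive degree it is
homotopic to zero by the Cartan formula `i_x d + d i_x = θ_x` (`curryLeft_coboundary`), and it
commutes with `d` (`coboundary_lieDerivative`). Hence for `n ≥ 1` the algebra `L` acts by zero on the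
subquotient `HLⁿ` of the left representation `CLⁿ`, and it suffices that `CLⁿ` has no non-zero
subquotient on which `L` acts by scalars (`NoScalarSubquotient`).

For `n = 0` this holds because an irreducible bimodule is symmetric or anti-symmetric, so that its
left submodules are subbimodules; a scalar subquotient of the left module `M` would thus produce a
one-dimensional composition factor (`Bimodule.NoOneDimCompositionFactor.noScalarSubquotient`). The
property passes from `CLⁿ` to `CLⁿ⁺¹ = Hom(L, CLⁿ)`: the chain of ideals filters `Hom(L, CLⁿ)` with
factors that embed into twists of `CLⁿ` by characters
(`noScalarSubquotient_lieDerivative_succ`).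

In degree zero `HL⁰` is the space of right invariants of `M`. It contains `M₀`, and `L` acts by zero
on the quotient, so that the two spaces coincide (`mem_antiSymmetricKernel_iff`).
-/

namespace LeibnizCohomology

section ScalarSubquotient

variable {F : Type*} [Field F] {ι V : Type*} [AddCommGroup V] [Module F V]

/-- No non-zero subquotient `C / A` of the representation `ρ` is acted on by scalars. A subspace is a
subrepresentation if it is stable under all `ρ x`; no compatibility of `ρ` with a multiplication on
`ι` is needed, and the scalars `χ x` are arbitrary. -/
def NoScalarSubquotient (ρ : ι → V →ₗ[F] V) : Prop :=
  ∀ A C : Submodule F V, A ≤ C → (∀ x, ∀ a ∈ A, ρ x a ∈ A) → (∀ x, ∀ c ∈ C, ρ x c ∈ C) →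
    ∀ χ : ι → F, (∀ x, ∀ c ∈ C, ρ x c - χ x • c ∈ A) → C ≤ A

end ScalarSubquotient

/-! ### From bimodule composition factors to left subquotients -/

section BimoduleFactors

variable {F : Type*} [Field F] {L : Type*} [NonUnitalNonAssocRing L] [Module F L]
  {M : Type*} [AddCommGroup M] [Module F M] (B : Bimodule F L M)

namespace Bimodule

theorem right_left_add_right (x y : L) (m : M) :
    B.right y (B.left x m + B.right x m) = 0 := by
  rw [map_add, B.lml, B.mll]
  abel

theorem left_left_add_right (x y : L) (m : M) :
    B.left y (B.left x m + B.right x m) =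
      (B.left (y * x) m + B.right (y * x) m) +
        (B.left x (B.left y m) + B.right x (B.left y m)) := by
  rw [map_add, B.llm, B.lml]
  abel

/-- An irreducible bimodule `N' / N` is symmetric or anti-symmetric, because its anti-symmetric
kernel is a subbimodule. In both cases the right action preserves every left submodule. -/
theorem isSubbimodule_of_left_mem {N N' : Submodule F M} (hN : B.IsSubbimodule N)
    (hN' : B.IsSubbimodule N') (hle : N ≤ N')
    (hirr : ∀ P : Submodule F M, B.IsSubbimodule P → N ≤ P → P ≤ N' → P = N ∨ P = N')
    {P : Submodule F M} (hNP : N ≤ P) (hPN' : P ≤ N') (hP : ∀ x, ∀ m ∈ P, B.left x m ∈ P) :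
    B.IsSubbimodule P := by
  set S : Submodule F M :=
    Submodule.span F {v | ∃ x : L, ∃ m ∈ N', v = B.left x m + B.right x m} with hS
  have hSN' : S ≤ N' := by
    rw [hS, Submodule.span_le]
    rintro _ ⟨x, m, hm, rfl⟩
    exact N'.add_mem (hN' x m hm).1 (hN' x m hm).2
  have hSright : ∀ y, S ≤ LinearMap.ker (B.right y) := by
    intro y
    rw [hS, Submodule.span_le]
    rintro _ ⟨x, m, -, rfl⟩
    exact B.right_left_add_right x y m
  have hSleft : ∀ y, S ≤ S.comap (B.left y) := by
    intro y
    conv_lhs => rw [hS]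
    rw [Submodule.span_le]
    rintro _ ⟨x, m, hm, rfl⟩
    rw [SetLike.mem_coe, Submodule.mem_comap, left_left_add_right]
    exact S.add_mem (Submodule.subset_span ⟨_, m, hm, rfl⟩)
      (Submodule.subset_span ⟨_, _, (hN' y m hm).1, rfl⟩)
  have hsub : B.IsSubbimodule (N ⊔ S) := by
    intro y v hv
    obtain ⟨n, hn, s, hs, rfl⟩ := Submodule.mem_sup.1 hv
    refine ⟨?_, ?_⟩
    · rw [map_add]
      exact Submodule.add_mem_sup (hN y n hn).1 (hSleft y hs)
    · rw [map_add, LinearMap.mem_ker.1 (hSright y hs), add_zero]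
      exact Submodule.mem_sup_left (hN y n hn).2
  rcases hirr _ hsub le_sup_left (sup_le hle hSN') with h | h
  · -- the factor `N' / N` is symmetric
    refine fun x m hm => ⟨hP x m hm, ?_⟩
    have h1 : B.left x m + B.right x m ∈ P :=
      hNP (h ▸ Submodule.mem_sup_right (Submodule.subset_span ⟨x, m, hPN' hm, rfl⟩))
    exact (Submodule.add_mem_iff_right P (hP x m hm)).1 h1
  · -- the right action on the factor `N' / N` is zero
    refine fun x m hm => ⟨hP x m hm, ?_⟩
    obtain ⟨n, hn, s, hs, rfl⟩ := Submodule.mem_sup.1 (h.symm ▸ hPN' hm : m ∈ N ⊔ S)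
    rw [map_add, LinearMap.mem_ker.1 (hSright x hs), add_zero]
    exact hNP (hN x n hn).2

theorem exists_compositionSeries [FiniteDimensional F M] : Nonempty B.CompositionSeries := by
  let T := {N : Submodule F M // B.IsSubbimodule N}
  let bot : T := ⟨⊥, fun x m hm => by simp [(Submodule.mem_bot F).1 hm]⟩
  let top : T := ⟨⊤, fun _ _ _ => ⟨trivial, trivial⟩⟩
  obtain ⟨a, h0, n, hn, hcov⟩ :=
    exists_covBy_seq_of_wellFoundedLT_wellFoundedGT_of_le
      (show bot ≤ top from bot_le (α := Submodule F M))
  exact ⟨{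
    length := n
    N := fun i => (a i).1
    zero := by simp [h0, bot]
    last := by simp [hn, top]
    isSubbimodule := fun i => (a i).2
    lt := fun i => (hcov i i.2).1
    irreducible := fun i P hP h1 h2 => by
      rcases (hcov i i.2).eq_or_eq (c := ⟨P, hP⟩) h1 h2 with h | h
      · exact Or.inl (congrArg Subtype.val h)
      · exact Or.inr (congrArg Subtype.val h) }⟩

theorem finrank_quotient_eq_one {N N' : Submodule F M} {v : M} (hv : v ∈ N') (hvN : v ∉ N)
    (h : N ⊔ F ∙ v = N') : Module.finrank F (N' ⧸ N.submoduleOf N') = 1 := by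
  refine finrank_eq_one_iff'.2 ⟨Submodule.Quotient.mk ⟨v, hv⟩, ?_, ?_⟩
  · rw [Ne, Submodule.Quotient.mk_eq_zero]
    exact hvN
  · intro w
    obtain ⟨⟨w, hw⟩, rfl⟩ := Submodule.Quotient.mk_surjective _ w
    obtain ⟨n, hn, s, hs, rfl⟩ := Submodule.mem_sup.1 (h.symm ▸ hw : w ∈ N ⊔ F ∙ v)
    obtain ⟨c, rfl⟩ := Submodule.mem_span_singleton.1 hs
    refine ⟨c, ?_⟩
    rw [← Submodule.Quotient.mk_smul, Submodule.Quotient.eq]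
    change c • v - (n + c • v) ∈ N
    simpa using hn

variable {B} in
/-- On a composition factor `N' / N` the images of `A` and `C` are each zero or everything. If they
differ, then `L` acts on `N' / N` by scalars, so every line in it is a subbimodule and the
irreducible factor is one-dimensional. -/
theorem NoOneDimCompositionFactor.noScalarSubquotient [FiniteDimensional F M]
    (hM : B.NoOneDimCompositionFactor) : NoScalarSubquotient (fun x => B.left x) := by
  obtain ⟨s⟩ := B.exists_compositionSeries
  intro A C hAC hA hC χ hχ
  have key : ∀ i, C ⊓ s.N i ≤ A := by
    intro i
    induction i using Fin.induction with
    | zero => simp [s.zero]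
    | succ i ih =>
      set N := s.N i.castSucc
      set N' := s.N i.succ
      have hle : N ≤ N' := (s.lt i).le
      have hN : B.IsSubbimodule N := s.isSubbimodule _
      have hN' : B.IsSubbimodule N' := s.isSubbimodule _
      have dich : ∀ D : Submodule F M, (∀ x, ∀ m ∈ D, B.left x m ∈ D) → N ≤ D → D ≤ N' →
          D = N ∨ D = N' := fun D hD h1 h2 =>
        s.irreducible i D (B.isSubbimodule_of_left_mem hN hN' hle (s.irreducible i) h1 h2 hD) h1 h2
      have stable : ∀ D : Submodule F M, (∀ x, ∀ m ∈ D, B.left x m ∈ D) →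
          ∀ x, ∀ m ∈ N ⊔ D ⊓ N', B.left x m ∈ N ⊔ D ⊓ N' := by
        intro D hD x m hm
        obtain ⟨n, hn, d, hd, rfl⟩ := Submodule.mem_sup.1 hm
        rw [map_add]
        exact Submodule.add_mem_sup (hN x n hn).1 ⟨hD x d hd.1, (hN' x d hd.2).1⟩
      have dichA := dich _ (stable A hA) le_sup_left (sup_le hle inf_le_right)
      have dichC := dich _ (stable C hC) le_sup_left (sup_le hle inf_le_right)
      -- either `C ⊓ N'` and `A ⊓ N'` have the same image in `N' / N`, or the image of `A ⊓ N'` is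
      -- zero and that of `C ⊓ N'` is everything
      by_cases hCA : N ⊔ C ⊓ N' ≤ N ⊔ A ⊓ N'
      · intro c hc
        obtain ⟨n, hn, a, ha, rfl⟩ := Submodule.mem_sup.1 (hCA (Submodule.mem_sup_right hc))
        have hnC : n ∈ C := (Submodule.add_mem_iff_left C (hAC ha.1)).1 hc.1
        exact A.add_mem (ih ⟨hnC, hn⟩) ha.1
      · have hAN : N ⊔ A ⊓ N' = N := by
          refine dichA.resolve_right fun h => hCA ?_
          rw [h]
          exact sup_le hle inf_le_right
        have hCN : N ⊔ C ⊓ N' = N' := by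
          refine dichC.resolve_left fun h => hCA ?_
          rw [h]
          exact le_sup_left
        exfalso
        obtain ⟨v, hv, hvN⟩ := SetLike.exists_of_lt (s.lt i)
        have hscalar : ∀ x, ∀ m ∈ N', B.left x m - χ x • m ∈ N := by
          intro x m hm
          obtain ⟨n, hn, c, hc, rfl⟩ := Submodule.mem_sup.1 (hCN.symm ▸ hm : m ∈ N ⊔ C ⊓ N')
          have h1 : B.left x c - χ x • c ∈ N := hAN ▸ Submodule.mem_sup_right
            ⟨hχ x c hc.1, N'.sub_mem (hN' x c hc.2).1 (N'.smul_mem _ hc.2)⟩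
          have h2 : B.left x n - χ x • n ∈ N := N.sub_mem (hN x n hn).1 (N.smul_mem _ hn)
          have := N.add_mem h2 h1
          rw [map_add, smul_add]
          convert this using 1
          abel
        have hspan : N ⊔ F ∙ v = N' := by
          have hvN' : N ⊔ F ∙ v ≤ N' :=
            sup_le hle ((Submodule.span_singleton_le_iff_mem _ _).2 hv)
          refine (dich _ ?_ le_sup_left hvN').resolve_left fun h => hvN ?_
          · intro x m hm
            have := Submodule.mem_sup_left (T := F ∙ v) (hscalar x m (hvN' hm))
            exact (Submodule.sub_mem_iff_left _ (Submodule.smul_mem _ _ hm)).1 this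
          · change v ∈ N
            rw [← h]
            exact Submodule.mem_sup_right (Submodule.mem_span_singleton_self v)
        exact hM s i (finrank_quotient_eq_one hv hvN hspan)
  simpa [s.last] using key (Fin.last _)

end Bimodule

end BimoduleFactors

/-! ### The Lie derivative and the Cartan formula -/

section LieDerivative

theorem removeNth_succ_cons {α : Type*} {n : ℕ} (x : α) (y : Fin (n + 1) → α) (j : Fin (n + 1)) :
    j.succ.removeNth (Fin.cons x y : Fin (n + 2) → α) = Fin.cons x (j.removeNth y) := by
  ext k
  cases k using Fin.cases <;> simp [Fin.removeNth]

variable {F : Type*} [Field F] {L : Type*} [NonUnitalNonAssocRing L] [Module F L]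
  {M : Type*} [AddCommGroup M] [Module F M]

theorem cochain_ext {n : ℕ} {f g : Cochain F L M (n + 1)}
    (h : ∀ x, f.curryLeft x = g.curryLeft x) : f = g :=
  (multilinearCurryLeftEquiv F (fun _ : Fin (n + 1) => L) M).injective (LinearMap.ext h)

variable [SMulCommClass F L L] (B : Bimodule F L M)

/-- The Lie derivative `θ_x` along `x` on cochains, that is the left action of `x` on
`Hom(L^{⊗ n}, M)` induced by the left action on `M` and by left multiplication on `L`. It is
defined by recursion on `n`, viewing an `(n + 1)`-cochain as a linear map from `L` to the
`n`-cochains; the closed formula is `lieDerivative_apply`. -/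
def lieDerivative (x : L) : (n : ℕ) → Cochain F L M n →ₗ[F] Cochain F L M n
  | 0 =>
    (MultilinearMap.constLinearEquivOfIsEmpty F F _ M).toLinearMap ∘ₗ B.left x ∘ₗ
      (MultilinearMap.constLinearEquivOfIsEmpty F F _ M).symm.toLinearMap
  | n + 1 =>
    (multilinearCurryLeftEquiv F (fun _ : Fin (n + 1) => L) M).symm.toLinearMap ∘ₗ
      (LinearMap.compRight F (lieDerivative x n) - LinearMap.lcomp F _ (LinearMap.mulLeft F x)) ∘ₗ
      (multilinearCurryLeftEquiv F (fun _ : Fin (n + 1) => L) M).toLinearMap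

theorem lieDerivative_zero_apply (x : L) (f : Cochain F L M 0) (y : Fin 0 → L) :
    lieDerivative B x 0 f y = B.left x (f y) := by
  rw [Subsingleton.elim y 0]
  rfl

theorem curryLeft_lieDerivative (x y : L) {n : ℕ} (f : Cochain F L M (n + 1)) :
    (lieDerivative B x (n + 1) f).curryLeft y =
      lieDerivative B x n (f.curryLeft y) - f.curryLeft (x * y) := rfl

theorem lieDerivative_apply (x : L) {n : ℕ} (f : Cochain F L M n) (y : Fin n → L) :
    lieDerivative B x n f y =
      B.left x (f y) - ∑ j, f (Function.update y j (x * y j)) := by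
  induction n with
  | zero => simp [lieDerivative_zero_apply]
  | succ n ih =>
    have h := congrArg (fun g => g (Fin.tail y)) (curryLeft_lieDerivative B x (y 0) f)
    simp only [sub_apply, MultilinearMap.curryLeft_apply, Fin.cons_self_tail, ih] at h
    rw [h, Fin.sum_univ_succ]
    have h0 : Fin.cons (x * y 0) (Fin.tail y) = Function.update y 0 (x * y 0) := by
      rw [← Fin.update_cons_zero (y 0) (Fin.tail y), Fin.cons_self_tail]
    rw [h0]
    simp only [Fin.cons_update, Fin.cons_self_tail]
    simp only [Fin.tail]
    abel

theorem lieDerivative_mul [IsLeftLeibniz L] (x y : L) {n : ℕ} (f : Cochain F L M n) :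
    lieDerivative B (x * y) n f =
      lieDerivative B x n (lieDerivative B y n f) - lieDerivative B y n (lieDerivative B x n f) := by
  induction n with
  | zero =>
    ext z
    simp [lieDerivative_zero_apply, B.llm]
  | succ n ih =>
    refine cochain_ext fun z => ?_
    have hz : x * (y * z) = x * y * z + y * (x * z) := IsLeftLeibniz.leibniz x y z
    change _ = (lieDerivative B x (n + 1) (lieDerivative B y (n + 1) f)).curryLeft z -
      (lieDerivative B y (n + 1) (lieDerivative B x (n + 1) f)).curryLeft z
    simp only [curryLeft_lieDerivative, map_sub, ih, hz, map_add]
    abel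

variable [IsScalarTower F L L]

theorem coboundary_zero_apply (f : Cochain F L M 0) (y : Fin 1 → L) :
    coboundary B 0 f y = - B.right (y 0) (f (Fin.tail y)) := by
  change coboundaryFun B 0 f y = _
  simp [coboundaryFun]

/-- The Cartan formula `i_x d + d i_x = θ_x`, where `i_x f = f.curryLeft x` inserts `x` as the first
argument. It holds in positive degree for all bimodules. -/
theorem curryLeft_coboundary (x : L) {n : ℕ} (f : Cochain F L M (n + 1)) :
    (coboundary B (n + 1) f).curryLeft x =
      lieDerivative B x (n + 1) f - coboundary B n (f.curryLeft x) := by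
  ext y
  rw [sub_apply, lieDerivative_apply, MultilinearMap.curryLeft_apply]
  change coboundaryFun B (n + 1) f _ = _ - coboundaryFun B n _ y
  have hIoi : ∀ (i : Fin (n + 1)) (g : Fin (n + 2) → M),
      ∑ j ∈ Finset.Ioi i.succ, g j = ∑ j ∈ Finset.Ioi i, g j.succ := by
    intro i g
    rw [← Fin.map_succEmb_Ioi, Finset.sum_map]
    rfl
  have hIoi0 : ∀ g : Fin (n + 2) → M, ∑ j ∈ Finset.Ioi 0, g j = ∑ j, g (Fin.succ j) := by
    intro g
    rw [Fin.Ioi_zero_eq_map, Finset.sum_map]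
    rfl
  simp only [coboundaryFun, Fin.sum_univ_succ (n := n), Fin.sum_univ_succ (n := n + 1), hIoi,
    hIoi0, ← Fin.succ_castSucc, ← Fin.succ_last, Fin.cons_succ, Fin.cons_zero,
    removeNth_succ_cons, ← Fin.cons_update, Fin.castSucc_zero, Fin.removeNth_zero, Fin.tail_cons,
    MultilinearMap.curryLeft_apply, Fin.val_succ, Fin.val_zero, pow_succ, pow_zero, one_smul,
    mul_neg, neg_smul, mul_one, Finset.sum_neg_distrib]
  abel

variable [IsLeftLeibniz L]

/-- `d` commutes with `θ_x`. In positive degree this follows by induction from the Cartan formula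
and from `[θ_x, θ_y] = θ_{xy}` and `[θ_x, i_y] = i_{xy}`. -/
theorem coboundary_lieDerivative (x : L) {n : ℕ} (f : Cochain F L M n) :
    coboundary B n (lieDerivative B x n f) = lieDerivative B x (n + 1) (coboundary B n f) := by
  induction n with
  | zero =>
    ext y
    rw [lieDerivative_apply]
    simp only [coboundary_zero_apply, lieDerivative_zero_apply, B.lml]
    have : ∀ z, Fin.tail (Function.update y 0 z) = Fin.tail y := fun z => Subsingleton.elim _ _
    simp [this]
    abel
  | succ n ih =>
    refine cochain_ext fun y => ?_
    simp only [curryLeft_coboundary, curryLeft_lieDerivative, map_sub, ih, lieDerivative_mul B x y]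
    abel

/-- By the Cartan formula `θ_x` maps cocycles to coboundaries, so `L` acts by the scalar `0` on
cocycles modulo coboundaries. -/
theorem cocycles_le_coboundaries_of_noScalarSubquotient {n : ℕ}
    (h : NoScalarSubquotient fun x => lieDerivative B x (n + 1)) :
    cocycles B (n + 1) ≤ coboundaries B (n + 1) := by
  have hZ : ∀ x, ∀ f ∈ cocycles B (n + 1), lieDerivative B x (n + 1) f ∈ cocycles B (n + 1) := by
    intro x f hf
    rw [cocycles, LinearMap.mem_ker] at hf ⊢
    rw [coboundary_lieDerivative, hf, map_zero]
  refine le_trans (h (coboundaries B (n + 1) ⊓ cocycles B (n + 1)) _ inf_le_right ?_ hZ 0 ?_)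
    inf_le_left
  · rintro x _ ⟨⟨f, rfl⟩, hf⟩
    exact ⟨⟨_, coboundary_lieDerivative B x f⟩, hZ x _ hf⟩
  · intro x f hf
    have h1 := curryLeft_coboundary B x f
    rw [LinearMap.mem_ker.1 hf] at h1
    rw [Pi.zero_apply, zero_smul, sub_zero]
    exact ⟨⟨f.curryLeft x, (sub_eq_zero.1 h1.symm).symm⟩, hZ x f hf⟩

end LieDerivative

/-! ### Cochains over a supersolvable algebra -/

section Supersolvable

variable {F : Type*} [Field F] {L : Type*} [NonUnitalNonAssocRing L] [Module F L]
  {M : Type*} [AddCommGroup M] [Module F M]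

theorem exists_smul_sub_mem_of_finrank_quotient_eq_one {I J : Submodule F L}
    (h : Module.finrank F (J ⧸ I.submoduleOf J) = 1) :
    ∃ e ∈ J, ∀ y ∈ J, ∃ c : F, y - c • e ∈ I := by
  obtain ⟨e, -, he⟩ := finrank_eq_one_iff'.1 h
  obtain ⟨⟨e, heJ⟩, rfl⟩ := Submodule.Quotient.mk_surjective _ e
  refine ⟨e, heJ, fun y hy => ?_⟩
  obtain ⟨c, hc⟩ := he (Submodule.Quotient.mk ⟨y, hy⟩)
  rw [← Submodule.Quotient.mk_smul, eq_comm, Submodule.Quotient.eq] at hc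
  exact ⟨c, hc⟩

variable [SMulCommClass F L L] {B : Bimodule F L M}

/-- Filter `Hom(L, CLⁿ)` by the subspaces of maps vanishing on the ideals of a chain with
one-dimensional factors: the successive factors embed into `CLⁿ`, up to twisting the action by the
character through which `L` acts on the corresponding factor of the chain. -/
theorem noScalarSubquotient_lieDerivative_succ (hL : IsSupersolvable F L) {n : ℕ}
    (h : NoScalarSubquotient fun x => lieDerivative B x n) :
    NoScalarSubquotient fun x => lieDerivative B x (n + 1) := by
  obtain ⟨k, I, hI0, hIk, hI, hstep⟩ := hL
  intro A C hAC hA hC χ hχ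
  have key : ∀ j, ∀ f ∈ C, (∀ y ∈ I j, f.curryLeft y = 0) → f ∈ A := by
    intro j
    induction j using Fin.reverseInduction with
    | last =>
      intro f _ hf
      have : f = 0 := cochain_ext fun y => hf y (by simp [hIk])
      exact this ▸ A.zero_mem
    | cast j ih =>
      obtain ⟨e, he, hspan⟩ := exists_smul_sub_mem_of_finrank_quotient_eq_one (hstep j).2
      choose μ hμ using fun x => hspan (x * e) (hI j.succ x e he).1
      -- the cochains vanishing when the first argument lies in `I j`
      let K : Submodule F (Cochain F L M (n + 1)) :=
        { carrier := {f | ∀ y ∈ I j.castSucc, f.curryLeft y = 0}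
          zero_mem' := fun _ _ => rfl
          add_mem' := fun {f g} hf hg y hy => by
            change f.curryLeft y + g.curryLeft y = 0
            rw [hf y hy, hg y hy, add_zero]
          smul_mem' := fun c f hf y hy => by
            change c • f.curryLeft y = 0
            rw [hf y hy, smul_zero] }
      let ev : Cochain F L M (n + 1) →ₗ[F] Cochain F L M n :=
        LinearMap.applyₗ e ∘ₗ (multilinearCurryLeftEquiv F (fun _ : Fin (n + 1) => L) M).toLinearMap
      have hK : ∀ x, ∀ f ∈ K, lieDerivative B x (n + 1) f ∈ K := by
        intro x f hf y hy
        rw [curryLeft_lieDerivative, hf y hy, hf _ (hI _ x y hy).1, map_zero, sub_zero]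
      have hev : ∀ x, ∀ f ∈ K,
          lieDerivative B x n (ev f) = ev (lieDerivative B x (n + 1) f) + μ x • ev f := by
        intro x f hf
        have h1 : f.curryLeft (x * e) = μ x • f.curryLeft e := by
          have := hf _ (hμ x)
          rwa [map_sub, map_smul, sub_eq_zero] at this
        change lieDerivative B x n (f.curryLeft e) =
          (lieDerivative B x (n + 1) f).curryLeft e + μ x • f.curryLeft e
        rw [curryLeft_lieDerivative, h1, sub_add_cancel]
      have hstable : ∀ D : Submodule F (Cochain F L M (n + 1)),
          (∀ x, ∀ f ∈ D, lieDerivative B x (n + 1) f ∈ D) →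
          ∀ x, ∀ g ∈ (D ⊓ K).map ev, lieDerivative B x n g ∈ (D ⊓ K).map ev := by
        rintro D hD x _ ⟨f, hf, rfl⟩
        rw [hev x f hf.2]
        exact Submodule.add_mem _ ⟨_, ⟨hD x f hf.1, hK x f hf.2⟩, rfl⟩
          (Submodule.smul_mem _ _ ⟨f, hf, rfl⟩)
      have hle : (C ⊓ K).map ev ≤ (A ⊓ K).map ev := by
        refine h _ _ (Submodule.map_mono (inf_le_inf_right K hAC)) (hstable A hA)
          (hstable C hC) (fun x => χ x + μ x) ?_
        rintro x _ ⟨f, hf, rfl⟩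
        refine ⟨lieDerivative B x (n + 1) f - χ x • f,
          ⟨hχ x f hf.1, K.sub_mem (hK x f hf.2) (K.smul_mem _ hf.2)⟩, ?_⟩
        simp only [hev x f hf.2, map_sub, map_smul, add_smul]
        abel
      intro f hfC hfK
      obtain ⟨a, ha, hae⟩ := hle ⟨f, ⟨hfC, hfK⟩, rfl⟩
      refine (Submodule.sub_mem_iff_left A ha.1).1 (ih _ (C.sub_mem hfC (hAC ha.1)) fun y hy => ?_)
      obtain ⟨c, hc⟩ := hspan y hy
      have hvanish : (f - a).curryLeft (y - c • e) = 0 := K.sub_mem hfK ha.2 _ hc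
      have heval : (f - a).curryLeft e = 0 := sub_eq_zero.2 hae.symm
      rwa [map_sub, map_smul, heval, smul_zero, sub_zero] at hvanish
  exact fun f hf => key 0 f hf fun y hy => by
    rw [hI0, Submodule.mem_bot] at hy
    rw [hy, map_zero]

theorem noScalarSubquotient_lieDerivative (hL : IsSupersolvable F L)
    (h : NoScalarSubquotient fun x => B.left x) (n : ℕ) :
    NoScalarSubquotient fun x => lieDerivative B x n := by
  induction n with
  | zero =>
    let ev : Cochain F L M 0 ≃ₗ[F] M := (MultilinearMap.constLinearEquivOfIsEmpty F F _ M).symm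
    have hev : ∀ x f, ev (lieDerivative B x 0 f) = B.left x (ev f) := fun _ _ => rfl
    have hstable : ∀ D : Submodule F (Cochain F L M 0), (∀ x, ∀ f ∈ D, lieDerivative B x 0 f ∈ D) →
        ∀ x, ∀ m ∈ D.map ev.toLinearMap, B.left x m ∈ D.map ev.toLinearMap := by
      rintro D hD x _ ⟨f, hf, rfl⟩
      exact ⟨_, hD x f hf, hev x f⟩
    intro A C hAC hA hC χ hχ
    refine (Submodule.map_le_map_iff_of_injective ev.injective _ _).1
      (h _ _ (Submodule.map_mono hAC) (hstable A hA) (hstable C hC) χ ?_)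
    rintro x _ ⟨f, hf, rfl⟩
    exact ⟨_, hχ x f hf, by simp [hev]⟩
  | succ n ih => exact noScalarSubquotient_lieDerivative_succ hL ih

end Supersolvable

/-! ### The anti-symmetric kernel and cohomology in degree zero -/

section DegreeZero

variable {F : Type*} [Field F] {L : Type*} [NonUnitalNonAssocRing L] [Module F L]
  {M : Type*} [AddCommGroup M] [Module F M] {B : Bimodule F L M}

/-- The right invariants contain the anti-symmetric kernel, and `L` acts by zero on the quotient,
since `x · m = x · m + m · x` if `m` is a right invariant. -/
theorem mem_antiSymmetricKernel_iff (h : NoScalarSubquotient fun x => B.left x) {m : M} :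
    m ∈ B.antiSymmetricKernel ↔ ∀ x, B.right x m = 0 := by
  let R : Submodule F M := ⨅ x, LinearMap.ker (B.right x)
  have hR : ∀ {m}, m ∈ R ↔ ∀ x, B.right x m = 0 := by
    intro m
    simp [R, Submodule.mem_iInf]
  have hle : B.antiSymmetricKernel ≤ R := by
    refine Submodule.span_le.2 ?_
    rintro _ ⟨x, m, rfl⟩
    exact hR.2 fun y => B.right_left_add_right x y m
  refine Iff.trans ⟨fun hm => hle hm, fun hm => ?_⟩ hR
  refine h B.antiSymmetricKernel R hle ?_ ?_ 0 ?_ hm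
  · intro x
    change B.antiSymmetricKernel ≤ B.antiSymmetricKernel.comap (B.left x)
    refine Submodule.span_le.2 ?_
    rintro _ ⟨y, m, rfl⟩
    rw [SetLike.mem_coe, Submodule.mem_comap, B.left_left_add_right]
    exact Submodule.add_mem _ (Submodule.subset_span ⟨_, _, rfl⟩)
      (Submodule.subset_span ⟨_, _, rfl⟩)
  · intro x m hm
    rw [hR] at hm ⊢
    intro y
    rw [B.lml, hm, hm, map_zero, sub_zero]
  · intro x m hm
    rw [Pi.zero_apply, zero_smul, sub_zero, ← add_zero (B.left x m), ← hR.1 hm x]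
    exact Submodule.subset_span ⟨x, m, rfl⟩

theorem Bimodule.IsSymmetric.antiSymmetricKernel_eq_bot (h : B.IsSymmetric) :
    B.antiSymmetricKernel = ⊥ := by
  refine Submodule.span_eq_bot.2 ?_
  rintro _ ⟨x, m, rfl⟩
  rw [h x m, add_neg_cancel]

variable [IsScalarTower F L L] [SMulCommClass F L L]

theorem mem_cocycles_zero_iff {f : Cochain F L M 0} :
    f ∈ cocycles B 0 ↔ ∀ x, B.right x (f 0) = 0 := by
  rw [cocycles, LinearMap.mem_ker]
  have h0 : ∀ y : Fin 0 → L, y = 0 := fun y => Subsingleton.elim _ _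
  constructor
  · intro h x
    have h1 : coboundary B 0 f (fun _ => x) = 0 := by rw [h]; rfl
    rwa [coboundary_zero_apply, neg_eq_zero, h0 (Fin.tail fun _ : Fin 1 => x)] at h1
  · intro h
    ext y
    simp only [coboundary_zero_apply]
    rw [h0 (Fin.tail y), h, neg_zero]
    rfl

theorem nonempty_HL_zero_equiv (h : NoScalarSubquotient fun x => B.left x) :
    Nonempty (HL B 0 ≃ₗ[F] B.antiSymmetricKernel) := by
  let ev : Cochain F L M 0 ≃ₗ[F] M := (MultilinearMap.constLinearEquivOfIsEmpty F F _ M).symm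
  have hmap : (cocycles B 0).map ev.toLinearMap = B.antiSymmetricKernel := by
    ext m
    rw [mem_antiSymmetricKernel_iff h]
    constructor
    · rintro ⟨f, hf, rfl⟩
      exact mem_cocycles_zero_iff.1 hf
    · intro hm
      exact ⟨ev.symm m, mem_cocycles_zero_iff.2 hm, ev.apply_symm_apply m⟩
  have hbot : (coboundaries B 0).submoduleOf (cocycles B 0) = ⊥ :=
    Submodule.ker_subtype _
  exact ⟨(Submodule.quotEquivOfEqBot _ hbot).trans
    ((ev.submoduleMap (cocycles B 0)).trans (LinearEquiv.ofEq _ _ hmap))⟩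

end DegreeZero

end LeibnizCohomology
theorem theorem4p9 {F : Type*} [Field F] [IsAlgClosed F]
    {L : Type*} [NonUnitalNonAssocRing L] [Module F L] [IsScalarTower F L L] [SMulCommClass F L L]
    [LeibnizCohomology.IsLeftLeibniz L]
    (hL : LeibnizCohomology.IsSupersolvable F L)
    {M : Type*} [AddCommGroup M] [Module F M] [FiniteDimensional F M]
    (B : LeibnizCohomology.Bimodule F L M)
    (hM : B.NoOneDimCompositionFactor) :
    Nonempty (LeibnizCohomology.HL B 0 ≃ₗ[F] B.antiSymmetricKernel) ∧
    (∀ n : ℕ, 1 ≤ n → Subsingleton (LeibnizCohomology.HL B n)) ∧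
    (B.IsSymmetric → ∀ n : ℕ, Subsingleton (LeibnizCohomology.HL B n)) := by
  have h := hM.noScalarSubquotient
  obtain ⟨e⟩ := LeibnizCohomology.nonempty_HL_zero_equiv h
  have hpos : ∀ n : ℕ, 1 ≤ n → Subsingleton (LeibnizCohomology.HL B n) := by
    intro n hn
    obtain ⟨n, rfl⟩ := Nat.exists_eq_add_of_le' hn
    rw [Submodule.Quotient.subsingleton_iff, Submodule.submoduleOf_eq_top]
    exact LeibnizCohomology.cocycles_le_coboundaries_of_noScalarSubquotient B
      (LeibnizCohomology.noScalarSubquotient_lieDerivative hL h (n + 1))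
  refine ⟨⟨e⟩, hpos, fun hsymm n => ?_⟩
  rcases n with _ | n
  · have := (Submodule.subsingleton_iff_eq_bot).2 hsymm.antiSymmetricKernel_eq_bot
    exact e.toEquiv.subsingleton
  · exact hpos _ n.succ_pos
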